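/- Let ${\rm elh}(\mathbb{C})$ be the set of all entire functions $f:\mathbb{C}\to\mathbb{C}$ such that $f'(z)\neq 0$ for every $z\in\mathbb{C}$ and $f'(0)=1$, and let ${\rm Aut}(\mathbb{C})=\{z\mapsto z+a : a\in\mathbb{C}\}$. Let $f(z)=\int_0^z e^{-t^2}\,dt$ for $z\in\mathbb{C}$, the integral being taken along any path from $0$ to $z$, for example the straight segment. Then: 1. $f\in{\rm elh}(\mathbb{C})\setminus{\rm Aut}(\mathbb{C})$; 2. $f(\mathbb{C})=\mathbb{C}$; 3. there are no functions $g,L\in{\rm elh}(\mathbb{C})\setminus{\rm Aut}(\mathbb{C})$ with $L(\mathbb{C})=\mathbb{C}$ such that $f(z)=g(L(z))$ for all $z\in\mathbb{C}$. -/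

import Mathlib

/-- The class of entire local homeomorphisms of the plane: entire functions `f` whose derivative
vanishes nowhere, normalized by `f' 0 = 1`. -/
def elh : Set (ℂ → ℂ) :=
  {f | Differentiable ℂ f ∧ (∀ z : ℂ, deriv f z ≠ 0) ∧ deriv f 0 = 1}

/-- The normalized automorphisms of the plane: the translations `z ↦ z + a`. -/
def autC : Set (ℂ → ℂ) :=
  {f | ∃ a : ℂ, ∀ z : ℂ, f z = z + a}

/-- The integral of `exp (-t ^ 2)` from `0` to `z` in the complex plane, taken along the segment
`t = s * z`, `0 ≤ s ≤ 1` (so that `dt = z ds`); the integrand is entire, so every other path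
from `0` to `z` gives the same value. -/
noncomputable def calabiFun (z : ℂ) : ℂ :=
  ∫ s in (0 : ℝ)..1, Complex.exp (-((s : ℂ) * z) ^ 2) * z

open Real Metric MeasureTheory Set

theorem log_norm_le_circleAverage {F : ℂ → ℂ} (hF : Differentiable ℂ F) {c : ℂ} (hc : F c ≠ 0)
    {R : ℝ} (hR : 0 < R) : log ‖F c‖ ≤ circleAverage (log ‖F ·‖) c R := by
  have hA : AnalyticOnNhd ℂ F (closedBall c |R|) := fun z _ => hF.analyticAt z
  rw [hA.circleAverage_log_norm hR.ne' hc]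
  refine le_add_of_nonneg_left (finsum_nonneg fun u => ?_)
  by_cases hu : u ∈ closedBall c |R|
  · refine mul_nonneg (mod_cast MeromorphicOn.AnalyticOnNhd.divisor_nonneg hA u) ?_
    rcases eq_or_ne c u with rfl | hcu
    · simp
    · have h0 : 0 < ‖c - u‖ := norm_pos_iff.2 (sub_ne_zero.2 hcu)
      apply log_nonneg
      rw [← div_eq_mul_inv, one_le_div h0]
      rwa [mem_closedBall, dist_comm, dist_eq_norm, abs_of_pos hR] at hu
  · simp [hu]

theorem posLog_norm_le_circleAverage {F : ℂ → ℂ} (hF : Differentiable ℂ F) (c : ℂ)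
    {R : ℝ} (hR : 0 < R) : log⁺ ‖F c‖ ≤ circleAverage (log⁺ ‖F ·‖) c R := by
  have hm : MeromorphicOn F (sphere c |R|) := fun z _ => (hF.analyticAt z).meromorphicAt
  have h0 : 0 ≤ circleAverage (log⁺ ‖F ·‖) c R :=
    circleAverage_nonneg_of_nonneg fun _ _ => posLog_nonneg
  refine max_le h0 ?_
  rcases eq_or_ne (F c) 0 with hc | hc
  · simpa [hc] using h0
  · exact (log_norm_le_circleAverage hF hc hR).trans <|
      circleAverage_mono hm.circleIntegrable_log_norm hm.circleIntegrable_posLog_norm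
        fun x _ => le_max_right _ _

theorem setIntegral_ball_eq_integral_circleAverage {ψ : ℂ → ℝ} (hψ : Continuous ψ) (c : ℂ)
    {R : ℝ} (hR : 0 < R) :
    ∫ z in ball c R, ψ z = ∫ ρ in (0 : ℝ)..R, 2 * π * ρ * circleAverage ψ c ρ := by
  have h1 : ∫ z in ball c R, ψ z = ∫ z, (ball (0 : ℂ) R).indicator (fun z => ψ (c + z)) z := by
    rw [← integral_indicator measurableSet_ball, ← integral_add_left_eq_self _ c]
    congr 1 with z
    simp [indicator]
  rw [h1, ← Complex.integral_comp_polarCoord_symm]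
  have h2 : ∀ p ∈ polarCoord.target,
      p.1 • (ball (0 : ℂ) R).indicator (fun z => ψ (c + z)) (Complex.polarCoord.symm p) =
        (Ioo 0 R ×ˢ Ioo (-π) π).indicator (fun p : ℝ × ℝ => p.1 * ψ (circleMap c p.1 p.2)) p := by
    rintro ⟨ρ, θ⟩ hp
    simp only [polarCoord_target, mem_prod, mem_Ioi] at hp
    have hn : ‖Complex.polarCoord.symm (ρ, θ)‖ = ρ := by
      rw [Complex.norm_polarCoord_symm, abs_of_pos hp.1]
    have hs : c + Complex.polarCoord.symm (ρ, θ) = circleMap c ρ θ := by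
      simp [circleMap, Complex.polarCoord_symm_apply, Complex.exp_mul_I]
    by_cases hρ : ρ < R
    · rw [indicator_of_mem (by rwa [mem_ball_zero_iff, hn]), indicator_of_mem (by simp_all), hs,
        smul_eq_mul]
    · rw [indicator_of_notMem (by rwa [mem_ball_zero_iff, hn]), indicator_of_notMem (by simp_all),
        smul_zero]
  have hsub : Ioo 0 R ×ˢ Ioo (-π) π ⊆ polarCoord.target := by
    rw [polarCoord_target]
    exact prod_mono Ioo_subset_Ioi_self subset_rfl
  have hcont : Continuous fun p : ℝ × ℝ => p.1 * ψ (circleMap c p.1 p.2) := by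
    unfold circleMap
    fun_prop
  rw [setIntegral_congr_fun polarCoord.open_target.measurableSet h2,
    setIntegral_indicator (measurableSet_Ioo.prod measurableSet_Ioo),
    inter_eq_self_of_subset_right hsub, Measure.volume_eq_prod, setIntegral_prod,
    intervalIntegral.integral_of_le hR.le, ← integral_Ioc_eq_integral_Ioo]
  · refine setIntegral_congr_fun measurableSet_Ioc fun ρ _ => ?_
    have hπ : -π ≤ π := by linarith [pi_pos]
    simp only
    rw [← integral_Ioc_eq_integral_Ioo, ← intervalIntegral.integral_of_le hπ,
      intervalIntegral.integral_const_mul, circleAverage_eq_integral_add (-π)]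
    have := intervalIntegral.integral_comp_add_right (a := 0) (b := 2 * π)
      (fun θ => ψ (circleMap c ρ θ)) (-π)
    rw [this, smul_eq_mul]
    have e : 2 * π + -π = π := by ring
    rw [zero_add, e]
    field_simp
  · rw [← Measure.volume_eq_prod]
    exact (hcont.continuousOn.integrableOn_compact
      (isCompact_Icc.prod isCompact_Icc)).mono_set
      (prod_mono Ioo_subset_Icc_self Ioo_subset_Icc_self)

theorem setIntegral_ball_le_of_circleAverage_le {ψ : ℂ → ℝ} (hψ : Continuous ψ) (c : ℂ)
    {R M : ℝ} (hR : 0 < R) (h : ∀ ρ ∈ Ioo 0 R, circleAverage ψ c ρ ≤ M) :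
    ∫ z in ball c R, ψ z ≤ π * R ^ 2 * M := by
  rw [setIntegral_ball_eq_integral_circleAverage hψ c hR]
  have hc := Continuous.circleAverage (c := c) hψ
  calc _ ≤ ∫ ρ in (0 : ℝ)..R, 2 * π * ρ * M := by
        refine intervalIntegral.integral_mono_on_of_le_Ioo hR.le
          (Continuous.intervalIntegrable (by fun_prop) _ _)
          (Continuous.intervalIntegrable (by fun_prop) _ _) fun ρ hρ => ?_
        have := hρ.1
        gcongr
        exact h ρ hρ
    _ = _ := by
        rw [intervalIntegral.integral_mul_const, intervalIntegral.integral_const_mul, integral_id]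
        ring

theorem le_setIntegral_ball_of_le_circleAverage {ψ : ℂ → ℝ} (hψ : Continuous ψ) (c : ℂ)
    {R M : ℝ} (hR : 0 < R) (h : ∀ ρ ∈ Ioo 0 R, M ≤ circleAverage ψ c ρ) :
    π * R ^ 2 * M ≤ ∫ z in ball c R, ψ z := by
  have := setIntegral_ball_le_of_circleAverage_le hψ.neg c hR (M := -M) fun ρ hρ => by
    have e : circleAverage (-ψ) c ρ = - circleAverage ψ c ρ := by
      simp [circleAverage]
    rw [e]
    exact neg_le_neg (h ρ hρ)
  simp only [Pi.neg_apply, integral_neg] at this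
  linarith

/-- A subharmonic estimate: `log⁺ ‖F‖` on the half disc is controlled by its circle averages. -/
theorem posLog_norm_le_of_circleAverage_le {F : ℂ → ℂ} (hF : Differentiable ℂ F) {c z : ℂ}
    {R B : ℝ} (hR : 0 < R) (h : ∀ ρ ∈ Ioo 0 R, circleAverage (log⁺ ‖F ·‖) c ρ ≤ B)
    (hz : ‖z - c‖ ≤ R / 2) : log⁺ ‖F z‖ ≤ 4 * B := by
  have hψ : Continuous fun w => log⁺ ‖F w‖ := continuous_posLog.comp hF.continuous.norm
  have h1 := le_setIntegral_ball_of_le_circleAverage hψ z (half_pos hR)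
    fun ρ hρ => posLog_norm_le_circleAverage hF z hρ.1
  have h2 := setIntegral_ball_le_of_circleAverage_le hψ c hR h
  have h3 : ∫ w in ball z (R / 2), log⁺ ‖F w‖ ≤ ∫ w in ball c R, log⁺ ‖F w‖ := by
    refine setIntegral_mono_set ?_ (ae_of_all _ fun _ => posLog_nonneg)
      (LE.le.eventuallyLE (ball_subset_ball' ?_))
    · exact (hψ.continuousOn.integrableOn_compact (isCompact_closedBall c R)).mono_set
        ball_subset_closedBall
    · rw [dist_eq_norm]
      linarith
  have h4 : 0 < π * R ^ 2 := by positivity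
  have h5 : π * R ^ 2 * log⁺ ‖F z‖ ≤ π * R ^ 2 * (4 * B) := by linarith
  exact le_of_mul_le_mul_left h5 h4

theorem circleAverage_mono_codiscreteWithin {f₁ f₂ : ℂ → ℝ} {c : ℂ} {R : ℝ} (hR : R ≠ 0)
    (h₁ : CircleIntegrable f₁ c R) (h₂ : CircleIntegrable f₂ c R)
    (h : ∀ᶠ z in Filter.codiscreteWithin (sphere c |R|), f₁ z ≤ f₂ z) :
    circleAverage f₁ c R ≤ circleAverage f₂ c R := by
  unfold circleAverage
  refine smul_le_smul_of_nonneg_left ?_ (by positivity)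
  refine intervalIntegral.integral_mono_ae_restrict two_pi_pos.le h₁ h₂ ?_
  exact ae_restrict_le_codiscreteWithin measurableSet_Icc
    (Filter.codiscreteWithin_mono (subset_univ _) (circleMap_preimage_codiscrete hR h))

/-- If `g ∘ L` is bounded on a disc, then so is `L` on the half disc. -/
theorem exists_posLog_norm_le_of_comp {g L : ℂ → ℂ} (hg : Differentiable ℂ g)
    (hL : Differentiable ℂ L) {c : ℂ} (hc : deriv g (L c) ≠ 0) :
    ∃ C : ℝ, 0 ≤ C ∧ ∀ R B : ℝ, 0 < R → (∀ z, ‖z - c‖ ≤ R → log⁺ ‖g (L z)‖ ≤ B) →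
      ∀ z, ‖z - c‖ ≤ R / 2 → log⁺ ‖L z‖ ≤ 4 * B + C := by
  set w := L c with hw
  set q := dslope g w with hq
  have hqd : Differentiable ℂ q := by
    rw [← differentiableOn_univ] at hg ⊢
    exact (Complex.differentiableOn_dslope Filter.univ_mem).2 hg
  have hQd : Differentiable ℂ (q ∘ L) := hqd.comp hL
  have hQc : (q ∘ L) c ≠ 0 := by simpa [q, ← hw] using hc
  obtain ⟨M, hM⟩ := (isCompact_closedBall w 1).exists_bound_of_continuousOn
    hqd.continuous.continuousOn
  have key : ∀ z, (q ∘ L) z ≠ 0 →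
      log⁺ ‖L z - w‖ + log ‖(q ∘ L) z‖ ≤ log⁺ ‖g (L z) - g w‖ + log⁺ M := by
    intro z hq0
    have hlM : 0 ≤ log⁺ M := posLog_nonneg
    have hlf : 0 ≤ log⁺ ‖g (L z) - g w‖ := posLog_nonneg
    rcases le_or_gt ‖L z - w‖ 1 with h | h
    · have h0 : log⁺ ‖L z - w‖ = 0 := by
        rw [posLog_eq_zero_iff, abs_of_nonneg (norm_nonneg _)]
        exact h
      have h1 : log ‖(q ∘ L) z‖ ≤ log⁺ M :=
        (le_max_right _ _).trans (posLog_le_posLog (norm_nonneg _)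
          (hM (L z) (by simpa [dist_eq_norm] using h)))
      linarith
    · rw [posLog_eq_log (by simpa using h.le)]
      have hne : L z ≠ w := fun h' => by simp [h', not_lt.2 zero_le_one] at h
      have hs : (L z - w) * (q ∘ L) z = g (L z) - g w := by
        simp only [Function.comp, q, dslope_of_ne _ hne, slope_def_field]
        field_simp [sub_ne_zero.2 hne]
      rw [← log_mul (by positivity) (norm_ne_zero_iff.2 hq0), ← norm_mul, hs]
      have : log ‖g (L z) - g w‖ ≤ log⁺ ‖g (L z) - g w‖ := le_max_right _ _
      linarith
  have hlog2 : 0 ≤ log 2 := log_nonneg one_le_two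
  have hMn : 0 ≤ log⁺ M := posLog_nonneg
  have hgn : 0 ≤ log⁺ ‖g w‖ := posLog_nonneg
  have hwn : 0 ≤ log⁺ ‖w‖ := posLog_nonneg
  refine ⟨4 * (log 2 + log⁺ ‖g w‖ + log⁺ M + |log ‖(q ∘ L) c‖|) + log 2 + log⁺ ‖w‖,
    by positivity, fun R B hR hB z hz => ?_⟩
  have hLw : Differentiable ℂ fun z => L z - w := hL.sub_const w
  have havg : ∀ ρ ∈ Ioo 0 R, circleAverage (fun z => log⁺ ‖L z - w‖) c ρ ≤
      B + (log 2 + log⁺ ‖g w‖ + log⁺ M + |log ‖(q ∘ L) c‖|) := by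
    intro ρ hρ
    have hi1 : CircleIntegrable (fun z => log⁺ ‖L z - w‖) c ρ :=
      MeromorphicOn.circleIntegrable_posLog_norm fun z _ => (hLw.analyticAt z).meromorphicAt
    have hi2 : CircleIntegrable (fun z => log ‖(q ∘ L) z‖) c ρ :=
      MeromorphicOn.circleIntegrable_log_norm fun z _ => (hQd.analyticAt z).meromorphicAt
    have hQ : ∀ᶠ z in Filter.codiscreteWithin (sphere c |ρ|), (q ∘ L) z ≠ 0 :=
      Filter.codiscreteWithin_mono (subset_univ _) <|
        AnalyticOnNhd.preimage_zero_mem_codiscrete (fun z _ => hQd.analyticAt z) hQc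
    have hJ := log_norm_le_circleAverage hQd hQc hρ.1
    have hcomb : circleAverage (fun z => log⁺ ‖L z - w‖ + log ‖(q ∘ L) z‖) c ρ ≤
        B + log 2 + log⁺ ‖g w‖ + log⁺ M := by
      rw [← circleAverage_const (B + log 2 + log⁺ ‖g w‖ + log⁺ M) c ρ]
      refine circleAverage_mono_codiscreteWithin hρ.1.ne' (hi1.add hi2)
        (circleIntegrable_const _ _ _) ?_
      filter_upwards [hQ, Filter.self_mem_codiscreteWithin _] with z hz hzs
      have h1 := key z hz
      have h2 : log⁺ ‖g (L z) - g w‖ ≤ log⁺ ‖g (L z)‖ + log⁺ ‖g w‖ + log 2 := by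
        simpa [sub_eq_add_neg, norm_neg, add_comm, add_left_comm] using
          posLog_norm_add_le (g (L z)) (-g w)
      have h3 := hB z (by
        rw [mem_sphere_iff_norm, abs_of_pos hρ.1] at hzs
        exact hzs.le.trans hρ.2.le)
      linarith
    have hadd : circleAverage (fun z => log⁺ ‖L z - w‖ + log ‖(q ∘ L) z‖) c ρ =
        circleAverage (fun z => log⁺ ‖L z - w‖) c ρ +
          circleAverage (fun z => log ‖(q ∘ L) z‖) c ρ := circleAverage_add hi1 hi2
    have := neg_abs_le (log ‖(q ∘ L) c‖)
    linarith
  have h1 := posLog_norm_le_of_circleAverage_le hLw hR havg hz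
  have h2 : log⁺ ‖L z‖ ≤ log⁺ ‖L z - w‖ + log⁺ ‖w‖ + log 2 := by
    simpa [add_comm, add_left_comm] using posLog_norm_add_le (L z - w) w
  linarith

theorem norm_le_quadratic_of_re_le {h : ℂ → ℂ} (hh : Differentiable ℂ h) {K : ℝ}
    (hK : ∀ z, (h z).re ≤ K * (1 + ‖z‖) ^ 2) : ∃ K', 0 < K' ∧ ∀ z, ‖h z‖ ≤ K' * (1 + ‖z‖) ^ 2 := by
  refine ⟨8 * (|K| + 1) + 3 * ‖h 0‖, by positivity, fun z => ?_⟩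
  set r := ‖z‖ with hr
  have hr0 : 0 ≤ r := norm_nonneg z
  have hz : z ∈ ball (0 : ℂ) (2 * r + 1) := by
    rw [mem_ball_zero_iff]; linarith
  have hb := Complex.borelCaratheodory (M := (|K| + 1) * (2 * (1 + r)) ^ 2) (R := 2 * r + 1)
    (by positivity) hh.differentiableOn ?_ (by positivity) hz
  · rw [← hr, show 2 * r + 1 - r = 1 + r by ring] at hb
    refine hb.trans ?_
    rw [← add_div, div_le_iff₀ (by positivity)]
    have h0 := norm_nonneg (h 0)
    have hk := abs_nonneg K
    have e1 : 2 * ((|K| + 1) * (2 * (1 + r)) ^ 2) * r ≤ 8 * (|K| + 1) * (1 + r) ^ 2 * (1 + r) := by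
      have : 0 ≤ 8 * (|K| + 1) * (1 + r) ^ 2 := by positivity
      nlinarith
    have e2 : ‖h 0‖ * (2 * r + 1 + r) ≤ 3 * ‖h 0‖ * (1 + r) ^ 2 * (1 + r) := by
      have : 2 * r + 1 + r ≤ 3 * (1 + r) ^ 2 * (1 + r) := by
        nlinarith [mul_nonneg hr0 hr0, mul_nonneg hr0 (mul_nonneg hr0 hr0)]
      nlinarith
    linarith
  · intro w hw
    rw [mem_ball_zero_iff] at hw
    refine (hK w).trans ?_
    have : K ≤ |K| + 1 := by linarith [le_abs_self K]
    gcongr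
    linarith

theorem exists_polynomial_of_norm_le {h : ℂ → ℂ} (hh : Differentiable ℂ h) {K : ℝ} {n : ℕ}
    (hK : ∀ z, ‖h z‖ ≤ K * (1 + ‖z‖) ^ n) :
    ∃ p : Polynomial ℂ, p.natDegree ≤ n ∧ ∀ z, h z = p.eval z := by
  have hvanish : ∀ m, n < m → iteratedDeriv m h 0 = 0 := by
    intro m hm
    have hK0 : 0 ≤ K := by simpa using (norm_nonneg _).trans (hK 0)
    have hlim : Filter.Tendsto (fun R : ℝ => m.factorial * K * 2 ^ n * R⁻¹) Filter.atTop
        (nhds (m.factorial * K * 2 ^ n * 0)) := tendsto_inv_atTop_zero.const_mul _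
    rw [mul_zero] at hlim
    refine norm_le_zero_iff.1 (ge_of_tendsto hlim ?_)
    filter_upwards [Filter.eventually_ge_atTop 1] with R hR
    have hR0 : 0 < R := by linarith
    refine (Complex.norm_iteratedDeriv_le_of_forall_mem_sphere_norm_le m hR0 hh.diffContOnCl
      (C := K * (2 * R) ^ n) fun z hz => ?_).trans ?_
    · rw [mem_sphere_zero_iff_norm] at hz
      refine (hK z).trans ?_
      gcongr
      linarith
    · rw [div_le_iff₀ (by positivity), mul_pow]
      have h1 : R ^ n ≤ R⁻¹ * R ^ m := by
        rw [le_inv_mul_iff₀ hR0, ← pow_succ']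
        exact pow_le_pow_right₀ hR hm
      calc (m.factorial : ℝ) * (K * (2 ^ n * R ^ n)) = m.factorial * K * 2 ^ n * R ^ n := by ring
        _ ≤ m.factorial * K * 2 ^ n * (R⁻¹ * R ^ m) := by gcongr
        _ = _ := by ring
  refine ⟨∑ m ∈ Finset.range (n + 1),
    Polynomial.C ((m.factorial : ℂ)⁻¹ * iteratedDeriv m h 0) * Polynomial.X ^ m, ?_, fun z => ?_⟩
  · refine Polynomial.natDegree_sum_le_of_forall_le _ _ fun m hm => ?_
    exact (Polynomial.natDegree_C_mul_X_pow_le _ _).trans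
      (Nat.lt_succ_iff.1 (Finset.mem_range.1 hm))
  · rw [← Complex.taylorSeries_eq_of_entire' 0 z hh, tsum_eq_sum (s := Finset.range (n + 1))]
    · simp [Polynomial.eval_finsetSum]
    · intro m hm
      rw [hvanish m (by simpa using hm)]
      simp

theorem exists_eq_C_of_eval_ne_zero {p : Polynomial ℂ} (hp : ∀ z, p.eval z ≠ 0) :
    ∃ a, p = Polynomial.C a := by
  by_contra! h
  have : 0 < p.degree := by
    by_contra hd
    exact h _ (Polynomial.eq_C_of_degree_le_zero (not_lt.1 hd))
  obtain ⟨z, hz⟩ := Complex.exists_root this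
  exact hp z hz

theorem deriv_eq_of_norm_le_of_deriv_ne_zero {h : ℂ → ℂ} (hh : Differentiable ℂ h) {K : ℝ} {n : ℕ}
    (hK : ∀ z, ‖h z‖ ≤ K * (1 + ‖z‖) ^ n) (hd : ∀ z, deriv h z ≠ 0) (z w : ℂ) :
    deriv h z = deriv h w := by
  obtain ⟨p, -, hp⟩ := exists_polynomial_of_norm_le hh hK
  have hp' : ∀ z, deriv h z = p.derivative.eval z := fun z => by
    rw [funext hp, Polynomial.deriv]
  obtain ⟨a, ha⟩ := exists_eq_C_of_eval_ne_zero (p := p.derivative) fun z => hp' z ▸ hd z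
  simp [hp', ha]

theorem exists_exp_eq_of_ne_zero {u : ℂ → ℂ} (hu : Differentiable ℂ u) (h0 : ∀ z, u z ≠ 0) :
    ∃ h : ℂ → ℂ, Differentiable ℂ h ∧ ∀ z, u z = Complex.exp (h z) := by
  have hd : Differentiable ℂ fun z => deriv u z / u z :=
    hu.contDiff.differentiable_deriv_two.div hu h0
  obtain ⟨H, hH⟩ := hd.isExactOn_univ
  have hv : ∀ z, HasDerivAt (fun z => u z * Complex.exp (-H z)) 0 z := fun z => by
    have := (hu z).hasDerivAt.mul (hH z trivial).neg.cexp
    refine this.congr_deriv ?_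
    field_simp [h0 z]
    ring
  have hconst : ∀ z, u z * Complex.exp (-H z) = u 0 * Complex.exp (-H 0) := fun z =>
    is_const_of_deriv_eq_zero (fun z => (hv z).differentiableAt) (fun z => (hv z).deriv) z 0
  refine ⟨fun z => H z + Complex.log (u 0 * Complex.exp (-H 0)),
    fun z => (hH z trivial).differentiableAt.add_const _, fun z => ?_⟩
  rw [Complex.exp_add, Complex.exp_log (mul_ne_zero (h0 0) (Complex.exp_ne_zero _)), ← hconst z,
    mul_left_comm, ← Complex.exp_add]
  simp

theorem eq_of_exp_eq_exp_const {φ : ℂ → ℂ} (hφ : Differentiable ℂ φ) {a : ℂ}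
    (h : ∀ z, Complex.exp (φ z) = a) (z w : ℂ) : φ z = φ w := by
  refine is_const_of_deriv_eq_zero hφ (fun z => ?_) z w
  have h1 : HasDerivAt (fun z => Complex.exp (φ z)) (Complex.exp (φ z) * deriv φ z) z :=
    (hφ z).hasDerivAt.cexp
  have h2 : deriv (fun z => Complex.exp (φ z)) z = 0 := by
    rw [funext h]
    exact deriv_const _ _
  rw [h1.deriv] at h2
  exact (mul_eq_zero.1 h2).resolve_left (Complex.exp_ne_zero _)

theorem norm_le_exp_posLog (z : ℂ) : ‖z‖ ≤ exp (log⁺ ‖z‖) := by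
  rcases eq_or_ne z 0 with rfl | h
  · simp
  · calc ‖z‖ = exp (log ‖z‖) := (exp_log (norm_pos_iff.2 h)).symm
      _ ≤ _ := exp_le_exp.2 (le_max_right _ _)

theorem posLog_norm_le_of_norm_le_exp {z : ℂ} {t : ℝ} (ht : 0 ≤ t) (h : ‖z‖ ≤ exp t) :
    log⁺ ‖z‖ ≤ t := by
  refine (posLog_le_posLog (norm_nonneg z) h).trans ?_
  rw [posLog_apply, log_exp, max_eq_right ht]

theorem hasDerivAt_calabiFun (z : ℂ) : HasDerivAt calabiFun (Complex.exp (-z ^ 2)) z := by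
  have hd : Differentiable ℂ fun z : ℂ => Complex.exp (-z ^ 2) := by fun_prop
  obtain ⟨F, hF⟩ := hd.isExactOn_univ
  have : calabiFun = fun z => F z - F 0 := by
    funext z
    have h1 : ∀ s ∈ uIcc (0 : ℝ) 1, HasDerivAt (fun s : ℝ => F (s * z))
        (Complex.exp (-((s : ℂ) * z) ^ 2) * z) s := fun s _ => by
      have := (hF (s * z) trivial).comp (s : ℂ) ((hasDerivAt_id (s : ℂ)).mul_const z)
      simpa using this.comp_ofReal
    rw [calabiFun, intervalIntegral.integral_eq_sub_of_hasDerivAt h1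
      (Continuous.intervalIntegrable (by fun_prop) _ _)]
    simp
  rw [this]
  exact (hF z trivial).sub_const _

theorem differentiable_calabiFun : Differentiable ℂ calabiFun :=
  fun z => (hasDerivAt_calabiFun z).differentiableAt

theorem deriv_calabiFun (z : ℂ) : deriv calabiFun z = Complex.exp (-z ^ 2) :=
  (hasDerivAt_calabiFun z).deriv

theorem norm_calabiFun_le (z : ℂ) : ‖calabiFun z‖ ≤ exp ((1 + ‖z‖) ^ 2) := by
  have h1 : ‖calabiFun z‖ ≤ exp (‖z‖ ^ 2) * ‖z‖ * |1 - 0| := by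
    refine intervalIntegral.norm_integral_le_of_norm_le_const fun s hs => ?_
    rw [uIoc_of_le zero_le_one] at hs
    rw [norm_mul, Complex.norm_exp]
    gcongr
    refine (Complex.re_le_norm _).trans ?_
    rw [norm_neg, norm_pow, norm_mul, Complex.norm_real, norm_of_nonneg hs.1.le]
    have := hs.1.le
    gcongr
    exact mul_le_of_le_one_left (norm_nonneg z) hs.2
  have h2 : ‖z‖ ≤ exp ‖z‖ := by linarith [add_one_le_exp ‖z‖]
  calc _ ≤ exp (‖z‖ ^ 2) * ‖z‖ := by simpa using h1
    _ ≤ exp (‖z‖ ^ 2) * exp ‖z‖ := by gcongr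
    _ = exp (‖z‖ ^ 2 + ‖z‖) := (exp_add _ _).symm
    _ ≤ _ := by
      gcongr
      nlinarith [norm_nonneg z]

theorem calabiFun_mem_elh : calabiFun ∈ elh :=
  ⟨differentiable_calabiFun, fun z => by simp [deriv_calabiFun], by simp [deriv_calabiFun]⟩

theorem calabiFun_notMem_autC : calabiFun ∉ autC := by
  rintro ⟨a, ha⟩
  have h : deriv calabiFun 1 = 1 := by simp [funext ha]
  rw [deriv_calabiFun] at h
  have := congrArg norm h
  rw [Complex.norm_exp] at this
  norm_num at this

theorem range_calabiFun : range calabiFun = univ := by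
  rw [eq_univ_iff_forall]
  intro a
  by_contra ha
  obtain ⟨q, hq, hqe⟩ := exists_exp_eq_of_ne_zero (differentiable_calabiFun.sub_const a)
    fun z h => ha ⟨z, sub_eq_zero.1 h⟩
  have hre : ∀ z, (q z).re ≤ (2 + ‖a‖) * (1 + ‖z‖) ^ 2 := by
    intro z
    have h1 : exp (q z).re ≤ exp ((1 + ‖z‖) ^ 2 + ‖a‖) := by
      rw [← Complex.norm_exp, ← hqe]
      refine (norm_sub_le _ _).trans ((add_le_add_left (norm_calabiFun_le z) _).trans ?_)
      rw [exp_add]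
      have h2 := add_one_le_exp ‖a‖
      have h3 : 1 ≤ exp ((1 + ‖z‖) ^ 2) := one_le_exp (by positivity)
      nlinarith [norm_nonneg a]
    have h4 := exp_le_exp.1 h1
    have h5 : 1 ≤ (1 + ‖z‖) ^ 2 := one_le_pow₀ (by linarith [norm_nonneg z])
    nlinarith [norm_nonneg a]
  obtain ⟨K, -, hK⟩ := norm_le_quadratic_of_re_le hq hre
  have hder : ∀ z, Complex.exp (-z ^ 2) = Complex.exp (q z) * deriv q z := by
    intro z
    have h1 := ((hasDerivAt_calabiFun z).sub_const a).deriv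
    rw [← h1, funext hqe]
    exact (hq z).hasDerivAt.cexp.deriv
  have hne : ∀ z, deriv q z ≠ 0 := fun z h => by simpa [h] using hder z
  set c := deriv q 0 with hc
  have hconst : ∀ z, deriv q z = c := fun z => deriv_eq_of_norm_le_of_deriv_ne_zero hq hK hne z 0
  have hlin : ∀ z, q z = q 0 + c * z := by
    intro z
    have hd : ∀ z, HasDerivAt (fun z => q z - c * z) 0 z := fun z => by
      refine ((hq z).hasDerivAt.sub ((hasDerivAt_id z).const_mul c)).congr_deriv ?_
      simp [hconst]
    have := is_const_of_deriv_eq_zero (fun z => (hd z).differentiableAt) (fun z => (hd z).deriv) z 0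
    simp only [mul_zero, sub_zero] at this
    rw [← this]
    ring
  have h0 := hder 0
  have h1 := hder 1
  have h2 := hder (-1)
  rw [hlin, hconst, Complex.exp_add] at h0 h1 h2
  have hmul : Complex.exp (c * 1) * Complex.exp (c * -1) = 1 := by
    rw [← Complex.exp_add]
    simp
  norm_num at h0 h1 h2
  have hsq : Complex.exp (-1) * Complex.exp (-1) = 1 := by
    nth_rw 1 [h1]
    rw [h2]
    simp only [mul_one, mul_neg] at hmul
    linear_combination (Complex.exp (q 0) * c) ^ 2 * hmul - (1 + Complex.exp (q 0) * c) * h0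
  have := congrArg norm hsq
  rw [← Complex.exp_add, Complex.norm_exp] at this
  norm_num at this

theorem mem_autC_of_calabiFun_eq_comp {g L : ℂ → ℂ} (hg : g ∈ elh) (hL : L ∈ elh)
    (hsurj : range L = univ) (hf : ∀ z, calabiFun z = g (L z)) : g ∈ autC ∨ L ∈ autC := by
  have eq_add : ∀ {F : ℂ → ℂ}, F ∈ elh → (∀ z, deriv F z = deriv F 0) → F ∈ autC := by
    rintro F ⟨hF, -, hF0⟩ h
    refine ⟨F 0, fun z => ?_⟩
    have hd : ∀ z, HasDerivAt (fun z => F z - z) 0 z := fun z => by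
      refine ((hF z).hasDerivAt.sub (hasDerivAt_id z)).congr_deriv ?_
      simp [h, hF0]
    have := is_const_of_deriv_eq_zero (fun z => (hd z).differentiableAt) (fun z => (hd z).deriv) z 0
    simp only [sub_zero] at this
    rw [← this]
    ring
  have hLd := hL.1
  have hgd := hg.1
  obtain ⟨C, hC0, hC⟩ := exists_posLog_norm_le_of_comp hgd hLd (hg.2.1 (L 0))
  have hLgrowth : ∀ z, log⁺ ‖L z‖ ≤ (36 + C) * (1 + ‖z‖) ^ 2 := by
    intro z
    have hz := norm_nonneg z
    have h1 := hC (2 * (1 + ‖z‖)) ((3 * (1 + ‖z‖)) ^ 2) (by positivity) (fun w hw => ?_) z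
      (by rw [sub_zero]; linarith)
    · have h2 : 1 ≤ (1 + ‖z‖) ^ 2 := one_le_pow₀ (by linarith)
      nlinarith
    · rw [sub_zero] at hw
      rw [← hf]
      refine posLog_norm_le_of_norm_le_exp (by positivity) ((norm_calabiFun_le w).trans ?_)
      gcongr
      linarith
  have hL'growth : ∀ z, ‖deriv L z‖ ≤ exp (4 * (36 + C) * (1 + ‖z‖) ^ 2) := by
    intro z
    have := Complex.norm_deriv_le_of_forall_mem_sphere_norm_le zero_lt_one
      (hLd.diffContOnCl (s := ball z 1)) (C := exp (4 * (36 + C) * (1 + ‖z‖) ^ 2)) fun w hw => ?_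
    · simpa using this
    · refine (norm_le_exp_posLog _).trans (exp_le_exp.2 ((hLgrowth w).trans ?_))
      have h1 : 1 + ‖w‖ ≤ 2 * (1 + ‖z‖) := by
        rw [mem_sphere_iff_norm] at hw
        linarith [norm_le_norm_add_norm_sub' w z, norm_nonneg z]
      calc _ ≤ (36 + C) * (2 * (1 + ‖z‖)) ^ 2 := by gcongr
        _ = _ := by ring
  obtain ⟨h, hh, hhe⟩ := exists_exp_eq_of_ne_zero hLd.contDiff.differentiable_deriv_two hL.2.1
  obtain ⟨k, hk, hke⟩ := exists_exp_eq_of_ne_zero hgd.contDiff.differentiable_deriv_two hg.2.1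
  obtain ⟨K, hK0, hK⟩ := norm_le_quadratic_of_re_le hh fun z => by
    have := hL'growth z
    rw [hhe, Complex.norm_exp] at this
    exact exp_le_exp.1 this
  have hφ : ∀ z, k (L z) + h z + z ^ 2 = k (L 0) + h 0 := by
    intro z
    have := eq_of_exp_eq_exp_const (φ := fun z => k (L z) + h z + z ^ 2) (a := 1)
      (((hk.comp hLd).add hh).add (differentiable_id.pow 2)) (fun z => ?_) z 0
    · simpa using this
    · have h1 : Complex.exp (-z ^ 2) = deriv g (L z) * deriv L z := by
        rw [← deriv_calabiFun, funext hf]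
        exact ((hgd (L z)).hasDerivAt.comp z (hLd z).hasDerivAt).deriv
      rw [Complex.exp_add, Complex.exp_add, ← hke, ← hhe, ← h1, ← Complex.exp_add]
      simp
  set a := k (L 0) + h 0 with ha
  have hkL : ∀ z, ‖k (L z)‖ ≤ (‖a‖ + K + 1) * (1 + ‖z‖) ^ 2 := by
    intro z
    have h1 : k (L z) = a - h z - z ^ 2 := by rw [← hφ z]; ring
    have h2 : ‖k (L z)‖ ≤ ‖a‖ + ‖h z‖ + ‖z‖ ^ 2 := by
      rw [h1, ← norm_pow]
      exact (norm_sub_le _ _).trans (add_le_add_left (norm_sub_le _ _) _)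
    have h3 := hK z
    have hz := norm_nonneg z
    have h4 : 1 ≤ (1 + ‖z‖) ^ 2 := one_le_pow₀ (by linarith)
    have h5 := norm_nonneg a
    nlinarith
  by_cases hk' : ∀ w, deriv k w = 0
  · left
    refine eq_add hg fun z => ?_
    rw [hke, hke, is_const_of_deriv_eq_zero hk hk' z 0]
  · right
    push Not at hk'
    obtain ⟨w, hw⟩ := hk'
    obtain ⟨c, rfl⟩ : w ∈ range L := hsurj ▸ mem_univ w
    obtain ⟨D, -, hD⟩ := exists_posLog_norm_le_of_comp hk hLd hw
    set A := (‖a‖ + K + 1) * (3 * (1 + ‖c‖)) ^ 2 with hA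
    have hA1 : 1 ≤ A := one_le_mul_of_one_le_of_one_le (by linarith [norm_nonneg a])
      (one_le_pow₀ (by linarith [norm_nonneg c]))
    refine eq_add hL fun z => deriv_eq_of_norm_le_of_deriv_ne_zero hLd (K := A ^ 4 * exp D) (n := 8)
      (fun z => ?_) hL.2.1 z 0
    have hz := norm_nonneg z
    have hcn := norm_nonneg c
    have hX1 : 1 ≤ A * (1 + ‖z‖) ^ 2 :=
      one_le_mul_of_one_le_of_one_le hA1 (one_le_pow₀ (by linarith))
    have hX0 : 0 < A * (1 + ‖z‖) ^ 2 := by linarith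
    have h1 := hD (2 * (1 + ‖z‖ + ‖c‖)) (log (A * (1 + ‖z‖) ^ 2)) (by positivity) (fun v hv => ?_) z
      (by linarith [norm_sub_le z c])
    · refine (norm_le_exp_posLog _).trans ((exp_le_exp.2 h1).trans_eq ?_)
      rw [exp_add, show (4 : ℝ) * log (A * (1 + ‖z‖) ^ 2) = (4 : ℕ) * log (A * (1 + ‖z‖) ^ 2) by
        norm_num, exp_nat_mul, exp_log hX0]
      ring
    · refine posLog_norm_le_of_norm_le_exp (log_nonneg hX1) ?_
      rw [exp_log hX0]
      have h2 : 1 + ‖v‖ ≤ 3 * (1 + ‖c‖) * (1 + ‖z‖) := by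
        nlinarith [norm_le_norm_add_norm_sub' v c, mul_nonneg hcn hz]
      calc _ ≤ (‖a‖ + K + 1) * (1 + ‖v‖) ^ 2 := hkL v
        _ ≤ (‖a‖ + K + 1) * (3 * (1 + ‖c‖) * (1 + ‖z‖)) ^ 2 := by gcongr
        _ = _ := by rw [hA]; ring

theorem theorem5 :
    calabiFun ∈ elh \ autC ∧
    Set.range calabiFun = Set.univ ∧
    ¬ ∃ g L : ℂ → ℂ, g ∈ elh \ autC ∧ L ∈ elh \ autC ∧ Set.range L = Set.univ ∧
      ∀ z : ℂ, calabiFun z = g (L z) := by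
  refine ⟨⟨calabiFun_mem_elh, calabiFun_notMem_autC⟩, range_calabiFun, ?_⟩
  rintro ⟨g, L, hg, hL, hsurj, hf⟩
  exact (mem_autC_of_calabiFun_eq_comp hg.1 hL.1 hsurj hf).elim hg.2 hL.2
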